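/- Let $A$ be a semisimple commutative complex Banach algebra (not necessarily unital), i.e. the intersection of the kernels of all characters of $A$ is $\{0\}$, and let $G$ be a locally compact (Hausdorff) group with a left Haar measure. Let $L^1(G,A)$ be the Banach algebra of (classes of) Bochner integrable functions $f:G\to A$ with norm $\|f\|=\int_G\|f(x)\|\,dx$ and convolution product $(f*g)(x)=\int_G f(y)\,g(y^{-1}x)\,dy$. For a complex Banach algebra $B$ let $\Delta(B)$ be the set of its non-zero multiplicative linear functionals with the Gelfand (weak-$*$) topology, and for $b\in B$ let $\hat b(\varphi)=\varphi(b)$ and $\hat B=\{\hat b: b\in B\}$. A bounded continuous function $\sigma:\Delta(B)\to\mathbb C$ is a BSE-function if there is $\beta>0$ with $$\Big|\sum_{i=1}^n c_i\sigma(\varphi_i)\Big|\le\beta\,\Big\|\sum_{i=1}^n c_i\varphi_i\Big\|_{B^*}$$ for all $n$, all $c_1,\dots,c_n\in\mathbb C$ and all $\varphi_1,\dots,\varphi_n\in\Delta(B)$. A BSE-function $\sigma$ is a BED-function if for every $\varepsilon>0$ there is a compact set $K\subseteq\Delta(B)$ such that $$\Big|\sum_{i=1}^n c_i\sigma(\varphi_i)\Big|\le\varepsilon\,\Big\|\sum_{i=1}^n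 c_i\varphi_i\Big\|_{B^*}$$ for all $n$, all $c_1,\dots,c_n\in\mathbb C$ and all $\varphi_1,\dots,\varphi_n\in\Delta(B)\setminus K$. Let $C^0_{\mathrm{BSE}}(\Delta(B))$ be the set of all BED-functions. $B$ is called a BED algebra if $B$ is commutative, $\Delta(B)\neq\emptyset$, and $C^0_{\mathrm{BSE}}(\Delta(B))=\hat B$. If $L^1(G,A)$ is a BED algebra, then $A$ is a BED algebra. -/

import Mathlib

open MeasureTheory WeakDual Filter Topology
open scoped ENNReal

/-! ### The convolution algebra `L¹(G, A)` -/

/-- The Banach space `L¹(G, A)` of (classes of) Bochner integrable functions `G → A`, with the norm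
`‖f‖ = ∫ ‖f x‖ dμ x`. It is a copy of `Lp A 1 μ`, which will carry the convolution product. -/
def GroupL1 {G : Type*} [MeasurableSpace G] (A : Type*) [NormedAddCommGroup A]
    (μ : Measure G) : Type _ :=
  Lp A 1 μ

namespace GroupL1

section Basic

variable {G : Type*} [MeasurableSpace G] {A : Type*} [NormedAddCommGroup A] {μ : Measure G}

noncomputable instance instNormedAddCommGroup : NormedAddCommGroup (GroupL1 A μ) :=
  inferInstanceAs (NormedAddCommGroup (Lp A 1 μ))

noncomputable instance instNormedSpace [NormedSpace ℂ A] : NormedSpace ℂ (GroupL1 A μ) :=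
  inferInstanceAs (NormedSpace ℂ (Lp A 1 μ))

instance instCompleteSpace [CompleteSpace A] : CompleteSpace (GroupL1 A μ) :=
  inferInstanceAs (CompleteSpace (Lp A 1 μ))

noncomputable instance instCoeFun : CoeFun (GroupL1 A μ) (fun _ => G → A) :=
  inferInstanceAs (CoeFun (Lp A 1 μ) (fun _ => G → A))

/-- The identity map onto `Lp A 1 μ`, as a linear isometry. -/
noncomputable def equivLp (A : Type*) [NormedAddCommGroup A] [NormedSpace ℂ A] (μ : Measure G) :
    GroupL1 A μ ≃ₗᵢ[ℂ] Lp A 1 μ :=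
  LinearIsometryEquiv.refl ℂ (Lp A 1 μ)

theorem norm_eq_integral (f : GroupL1 A μ) : ‖f‖ = ∫ x, ‖f x‖ ∂μ :=
  L1.norm_eq_integral_norm (f : Lp A 1 μ)

theorem integrable_coe (f : GroupL1 A μ) : Integrable (fun x => f x) μ :=
  L1.integrable_coeFn (f : Lp A 1 μ)

theorem coe_add_ae (f g : GroupL1 A μ) : ∀ᵐ x ∂μ, (f + g) x = f x + g x :=
  Lp.coeFn_add (f : Lp A 1 μ) g

theorem coe_smul_ae [NormedSpace ℂ A] (c : ℂ) (f : GroupL1 A μ) :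
    ∀ᵐ x ∂μ, (c • f) x = c • f x :=
  Lp.coeFn_smul c (f : Lp A 1 μ)

theorem ext_ae {f g : GroupL1 A μ} (h : ∀ᵐ x ∂μ, f x = g x) : f = g :=
  Lp.ext (f := (f : Lp A 1 μ)) (g := (g : Lp A 1 μ)) h

end Basic

section LeftMul

variable {G : Type*} [MeasurableSpace G] {A : Type*} [NonUnitalNormedRing A] [NormedSpace ℂ A]
  [IsScalarTower ℂ A A] [SMulCommClass ℂ A A] {μ : Measure G}

/-- For `a : A` and `F ∈ L¹(G, A)`, the function `x ↦ a * F x`. -/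
noncomputable def lmul (a : A) (F : GroupL1 A μ) : GroupL1 A μ :=
  (ContinuousLinearMap.mul ℂ A a).compLp (F : Lp A 1 μ)

theorem lmul_ae (a : A) (F : GroupL1 A μ) : ∀ᵐ x ∂μ, lmul a F x = a * F x :=
  (ContinuousLinearMap.mul ℂ A a).coeFn_compLp (F : Lp A 1 μ)

theorem norm_lmul_le (a : A) (F : GroupL1 A μ) : ‖lmul a F‖ ≤ ‖a‖ * ‖F‖ :=
  ((ContinuousLinearMap.mul ℂ A a).norm_compLp_le (F : Lp A 1 μ)).trans
    (mul_le_mul_of_nonneg_right (ContinuousLinearMap.opNorm_mul_apply_le ℂ A a) (norm_nonneg _))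

theorem lmul_lmul (a b : A) (F : GroupL1 A μ) : lmul a (lmul b F) = lmul (a * b) F := by
  apply ext_ae
  filter_upwards [lmul_ae a (lmul b F), lmul_ae b F, lmul_ae (a * b) F] with x h1 h2 h3
  rw [h1, h2, h3, mul_assoc]

/-- `lmul` as a bounded bilinear map. -/
noncomputable def lmulL (A : Type*) [NonUnitalNormedRing A] [NormedSpace ℂ A]
    [IsScalarTower ℂ A A] [SMulCommClass ℂ A A] (μ : Measure G) :
    A →L[ℂ] GroupL1 A μ →L[ℂ] GroupL1 A μ :=
  LinearMap.mkContinuous₂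
    (LinearMap.mk₂ ℂ (lmul (A := A) (μ := μ))
      (fun a b F => by
        apply ext_ae
        filter_upwards [lmul_ae a F, lmul_ae b F, lmul_ae (a + b) F,
          coe_add_ae (lmul a F) (lmul b F)] with x h1 h2 h3 h4
        rw [h3, h4, h1, h2, add_mul])
      (fun c a F => by
        apply ext_ae
        filter_upwards [lmul_ae a F, lmul_ae (c • a) F, coe_smul_ae c (lmul a F)] with x h1 h2 h3
        rw [h2, h3, h1, smul_mul_assoc])
      (fun a F F' => by
        apply ext_ae
        filter_upwards [lmul_ae a F, lmul_ae a F', lmul_ae a (F + F'), coe_add_ae F F',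
          coe_add_ae (lmul a F) (lmul a F')] with x h1 h2 h3 h4 h5
        rw [h3, h4, h5, h1, h2, mul_add])
      (fun c a F => by
        apply ext_ae
        filter_upwards [lmul_ae a F, lmul_ae a (c • F), coe_smul_ae c F,
          coe_smul_ae c (lmul a F)] with x h1 h2 h3 h4
        rw [h2, h3, h4, h1, mul_smul_comm]))
    1 (fun a F => by simpa using norm_lmul_le a F)

theorem lmulL_apply (a : A) (F : GroupL1 A μ) : lmulL A μ a F = lmul a F := rfl

end LeftMul

section Translate

variable {G : Type*} [Group G] [TopologicalSpace G] [IsTopologicalGroup G]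
  [MeasurableSpace G] [BorelSpace G]
  {A : Type*} [NormedAddCommGroup A] {μ : Measure G} [μ.IsMulLeftInvariant]

/-- The left translate `x ↦ F (y⁻¹ * x)` of `F ∈ L¹(G, A)` by `y : G`. -/
noncomputable def translate (y : G) (F : GroupL1 A μ) : GroupL1 A μ :=
  Lp.compMeasurePreserving (fun x => y⁻¹ * x) (measurePreserving_mul_left μ y⁻¹) (F : Lp A 1 μ)

theorem translate_ae (y : G) (F : GroupL1 A μ) :
    ∀ᵐ x ∂μ, translate y F x = F (y⁻¹ * x) :=
  Lp.coeFn_compMeasurePreserving (F : Lp A 1 μ) (measurePreserving_mul_left μ y⁻¹)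

theorem norm_translate (y : G) (F : GroupL1 A μ) : ‖translate y F‖ = ‖F‖ :=
  Lp.norm_compMeasurePreserving (F : Lp A 1 μ) (measurePreserving_mul_left μ y⁻¹)

theorem translate_add (y : G) (F F' : GroupL1 A μ) :
    translate y (F + F') = translate y F + translate y F' :=
  map_add (Lp.compMeasurePreserving (E := A) (p := 1) (fun x => y⁻¹ * x)
    (measurePreserving_mul_left μ y⁻¹)) _ _

theorem ae_mul_left {p : G → Prop} (y : G) (h : ∀ᵐ x ∂μ, p x) : ∀ᵐ x ∂μ, p (y * x) :=
  (measurePreserving_mul_left μ y).quasiMeasurePreserving.ae h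

theorem translate_translate (y z : G) (F : GroupL1 A μ) :
    translate y (translate z F) = translate (y * z) F := by
  apply ext_ae
  filter_upwards [translate_ae y (translate z F), ae_mul_left y⁻¹ (translate_ae z F),
    translate_ae (y * z) F] with x h1 h2 h3
  rw [h1, h2, h3, mul_inv_rev, mul_assoc]

theorem translate_smul [NormedSpace ℂ A] (y : G) (c : ℂ) (F : GroupL1 A μ) :
    translate y (c • F) = c • translate y F := by
  apply ext_ae
  filter_upwards [translate_ae y (c • F), ae_mul_left y⁻¹ (coe_smul_ae c F), translate_ae y F,
    coe_smul_ae c (translate y F)] with x h1 h2 h3 h4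
  rw [h1, h2, h4, h3]

/-- Translation by `y` as a bounded linear map. -/
noncomputable def translateL (A : Type*) [NormedAddCommGroup A] [NormedSpace ℂ A] (μ : Measure G)
    [μ.IsMulLeftInvariant] (y : G) : GroupL1 A μ →L[ℂ] GroupL1 A μ :=
  LinearMap.mkContinuous
    { toFun := translate y
      map_add' := translate_add y
      map_smul' := translate_smul y } 1
    (fun F => by simpa using (norm_translate y F).le)

theorem translateL_apply [NormedSpace ℂ A] (y : G) (F : GroupL1 A μ) :
    translateL A μ y F = translate y F := rfl

theorem continuous_translate [IsLocallyFiniteMeasure μ] [μ.InnerRegularCompactLTTop]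
    (F : GroupL1 A μ) : Continuous (fun y : G => translate y F) := by
  let k : C(G, C(G, G)) :=
    (ContinuousMap.mk (fun a : G × G => a.1⁻¹ * a.2) (by fun_prop)).curry
  exact Continuous.compMeasurePreservingLp (f := fun _ : G => (F : Lp A 1 μ)) (g := k)
    continuous_const k.continuous (fun y => measurePreserving_mul_left μ y⁻¹) ENNReal.one_ne_top

end Translate

section Measurability

/-- A continuous map into a metric space is almost everywhere strongly measurable on sets of finite
measure. -/
theorem aestronglyMeasurable_restrict_of_continuous {X E : Type*} [TopologicalSpace X] [T2Space X]
    [MeasurableSpace X] [BorelSpace X] {μ : Measure X} [μ.InnerRegularCompactLTTop]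
    [NormedAddCommGroup E] {h : X → E} (hh : Continuous h) {s : Set X} (hs : MeasurableSet s)
    (hμs : μ s ≠ ∞) : AEStronglyMeasurable h (μ.restrict s) := by
  have hex : ∀ n : ℕ, ∃ K ⊆ s, IsCompact K ∧ μ (s \ K) < ENNReal.ofReal (1 / ((n : ℝ) + 1)) :=
    fun n => hs.exists_isCompact_sdiff_lt hμs
      (ENNReal.ofReal_pos.2 (by positivity)).ne'
  choose K hKs hK hKμ using hex
  have hz : μ (s \ ⋃ n, K n) = 0 := by
    refine le_antisymm (ge_of_tendsto (x := atTop)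
      (f := fun n : ℕ => ENNReal.ofReal (1 / ((n : ℝ) + 1))) ?_ ?_) bot_le
    · have := ENNReal.tendsto_ofReal (tendsto_one_div_add_atTop_nhds_zero_nat (𝕜 := ℝ))
      simpa using this
    · refine Eventually.of_forall fun n => ?_
      exact (measure_mono (Set.sdiff_subset_sdiff_right (Set.subset_iUnion K n))).trans (hKμ n).le
  have hr : μ.restrict s = μ.restrict (⋃ n, K n) := by
    apply Measure.restrict_congr_set
    refine EventuallyLE.antisymm ?_ (LE.le.eventuallyLE (Set.iUnion_subset hKs))
    exact ae_le_set.2 hz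
  rw [hr, aestronglyMeasurable_iUnion_iff]
  exact fun n => hh.continuousOn.aestronglyMeasurable_of_isCompact (hK n) (hK n).measurableSet

end Measurability

section Convolution

set_option linter.unusedSectionVars false

variable {G : Type*} [Group G] [TopologicalSpace G] [IsTopologicalGroup G] [T2Space G]
  [MeasurableSpace G] [BorelSpace G]
  {A : Type*} [NonUnitalNormedRing A] [NormedSpace ℂ A]
  [IsScalarTower ℂ A A] [SMulCommClass ℂ A A]
  {μ : Measure G} [μ.IsMulLeftInvariant]

/-- The convolution `f ⋆ g = ∫ f y * g (y⁻¹ * ·) dμ y` of `f, g ∈ L¹(G, A)`, as a Bochner integral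
with values in `L¹(G, A)`. -/
noncomputable def conv (f g : GroupL1 A μ) : GroupL1 A μ :=
  ∫ y, lmul (f y) (translate y g) ∂μ

variable [IsLocallyFiniteMeasure μ] [μ.InnerRegularCompactLTTop]

theorem integrable_conv_integrand {f : G → A} (hf : Integrable f μ) (g : GroupL1 A μ) :
    Integrable (fun y => lmul (f y) (translate y g)) μ := by
  have hm : AEStronglyMeasurable (fun y => lmul (f y) (translate y g)) μ := by
    obtain ⟨t, ht, hft, hσ⟩ := hf.aefinStronglyMeasurable.exists_set_sigmaFinite
    have h1 : AEStronglyMeasurable (fun y => translate y g) (μ.restrict t) := by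
      have hS : μ.restrict t = (μ.restrict t).restrict (⋃ n, spanningSets (μ.restrict t) n) := by
        rw [iUnion_spanningSets, Measure.restrict_univ]
      rw [hS, aestronglyMeasurable_iUnion_iff]
      intro n
      have hn := measurableSet_spanningSets (μ.restrict t) n
      rw [Measure.restrict_restrict hn]
      refine aestronglyMeasurable_restrict_of_continuous (continuous_translate g) (hn.inter ht) ?_
      rw [← Measure.restrict_apply hn]
      exact (measure_spanningSets_lt_top _ n).ne
    have h2 : AEStronglyMeasurable (fun y => lmul (f y) (translate y g)) (μ.restrict t) :=
      (lmulL A μ).aestronglyMeasurable_comp₂ hf.1.restrict h1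
    have h3 : AEStronglyMeasurable (fun y => lmul (f y) (translate y g)) (μ.restrict tᶜ) := by
      refine aestronglyMeasurable_zero.congr (f := fun _ => (0 : GroupL1 A μ)) ?_
      filter_upwards [hft] with y hy
      have h0 : f y = 0 := hy
      rw [h0, ← lmulL_apply, map_zero]
      rfl
    have h4 := (aestronglyMeasurable_union_iff (s := t) (t := tᶜ)).2 ⟨h2, h3⟩
    rwa [Set.union_compl_self, Measure.restrict_univ] at h4
  refine Integrable.mono' (hf.norm.mul_const ‖g‖) hm (Eventually.of_forall fun y => ?_)
  simpa [norm_translate] using norm_lmul_le (f y) (translate y g)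

theorem conv_add_left (f f' g : GroupL1 A μ) : conv (f + f') g = conv f g + conv f' g := by
  unfold conv
  rw [← integral_add (integrable_conv_integrand f.integrable_coe g)
    (integrable_conv_integrand f'.integrable_coe g)]
  apply integral_congr_ae
  filter_upwards [coe_add_ae f f'] with y hy
  rw [hy, ← lmulL_apply, map_add]
  rfl

theorem conv_add_right (f g g' : GroupL1 A μ) : conv f (g + g') = conv f g + conv f g' := by
  unfold conv
  rw [← integral_add (integrable_conv_integrand f.integrable_coe g)
    (integrable_conv_integrand f.integrable_coe g')]
  simp only [translate_add, ← lmulL_apply, map_add]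

theorem conv_smul_left (c : ℂ) (f g : GroupL1 A μ) : conv (c • f) g = c • conv f g := by
  unfold conv
  rw [← integral_smul]
  apply integral_congr_ae
  filter_upwards [coe_smul_ae c f] with y hy
  rw [hy, ← lmulL_apply, map_smul]
  rfl

theorem conv_smul_right (c : ℂ) (f g : GroupL1 A μ) : conv f (c • g) = c • conv f g := by
  unfold conv
  rw [← integral_smul]
  simp only [translate_smul, ← lmulL_apply, map_smul]

theorem norm_conv_le (f g : GroupL1 A μ) : ‖conv f g‖ ≤ ‖f‖ * ‖g‖ := by
  rw [norm_eq_integral f, ← integral_mul_const]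
  refine norm_integral_le_of_norm_le (f.integrable_coe.norm.mul_const _)
    (Eventually.of_forall fun y => ?_)
  simpa [norm_translate] using norm_lmul_le (f y) (translate y g)

/-- Convolution as a bounded bilinear map. -/
noncomputable def convL (A : Type*) [NonUnitalNormedRing A] [NormedSpace ℂ A]
    [IsScalarTower ℂ A A] [SMulCommClass ℂ A A] (μ : Measure G) [μ.IsMulLeftInvariant]
    [IsLocallyFiniteMeasure μ] [μ.InnerRegularCompactLTTop] :
    GroupL1 A μ →L[ℂ] GroupL1 A μ →L[ℂ] GroupL1 A μ :=
  LinearMap.mkContinuous₂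
    (LinearMap.mk₂ ℂ conv conv_add_left conv_smul_left conv_add_right conv_smul_right)
    1 (fun f g => by simpa using norm_conv_le f g)

theorem convL_apply (f g : GroupL1 A μ) : convL A μ f g = conv f g := rfl

variable [CompleteSpace A]

theorem translate_lmul (y : G) (a : A) (F : GroupL1 A μ) :
    translate y (lmul a F) = lmul a (translate y F) := by
  apply ext_ae
  filter_upwards [translate_ae y (lmul a F), ae_mul_left y⁻¹ (lmul_ae a F), translate_ae y F,
    lmul_ae a (translate y F)] with x h1 h2 h3 h4
  rw [h1, h2, h4, h3]

theorem translate_conv (y : G) (g h : GroupL1 A μ) :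
    translate y (conv g h) = conv (translate y g) h := by
  have h1 : translate y (conv g h) = ∫ z, translate y (lmul (g z) (translate z h)) ∂μ :=
    ((translateL A μ y).integral_comp_comm (integrable_conv_integrand g.integrable_coe h)).symm
  rw [h1]
  simp only [translate_lmul, translate_translate]
  rw [← integral_mul_left_eq_self _ y⁻¹]
  apply integral_congr_ae
  filter_upwards [translate_ae y g] with z hz
  rw [hz, mul_inv_cancel_left]

theorem lmul_conv (a : A) (g h : GroupL1 A μ) : lmul a (conv g h) = conv (lmul a g) h := by
  have h1 : lmul a (conv g h) = ∫ z, lmul a (lmul (g z) (translate z h)) ∂μ :=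
    ((lmulL A μ a).integral_comp_comm (integrable_conv_integrand g.integrable_coe h)).symm
  rw [h1]
  apply integral_congr_ae
  filter_upwards [lmul_ae a g] with z hz
  rw [hz, lmul_lmul]

theorem conv_assoc (f g h : GroupL1 A μ) : conv (conv f g) h = conv f (conv g h) := by
  have h1 : conv (conv f g) h = ∫ y, conv (lmul (f y) (translate y g)) h ∂μ :=
    (((convL A μ).flip h).integral_comp_comm
      (integrable_conv_integrand f.integrable_coe g)).symm
  rw [h1]
  simp only [← lmul_conv, ← translate_conv]
  rfl

/-- `L¹(G, A)` with convolution is a Banach algebra. -/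
noncomputable instance instNonUnitalNormedRing : NonUnitalNormedRing (GroupL1 A μ) :=
  { (instNormedAddCommGroup : NormedAddCommGroup (GroupL1 A μ)) with
    mul := conv
    left_distrib := conv_add_right
    right_distrib := conv_add_left
    zero_mul := fun f => by
      have := (convL A μ).map_zero
      exact congrArg (fun T => T f) this
    mul_zero := fun f => (convL A μ f).map_zero
    mul_assoc := conv_assoc
    norm_mul_le := norm_conv_le }

theorem mul_def (f g : GroupL1 A μ) : f * g = ∫ y, lmul (f y) (translate y g) ∂μ := rfl

instance instIsScalarTower : IsScalarTower ℂ (GroupL1 A μ) (GroupL1 A μ) :=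
  ⟨fun c f g => conv_smul_left c f g⟩

instance instSMulCommClass : SMulCommClass ℂ (GroupL1 A μ) (GroupL1 A μ) :=
  ⟨fun c f g => (conv_smul_right c f g).symm⟩

/-- The product is the usual convolution `x ↦ ∫ f y * g (y⁻¹ * x) dμ y`, in integrated form. -/
theorem setIntegral_mul (f g : GroupL1 A μ) (s : Set G) :
    ∫ x in s, (f * g) x ∂μ = ∫ y, f y * ∫ x in s, g (y⁻¹ * x) ∂μ ∂μ := by
  let T : GroupL1 A μ →L[ℂ] A := LinearMap.mkContinuous
    { toFun := fun F => ∫ x in s, F x ∂μ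
      map_add' := fun F F' => by
        rw [← integral_add F.integrable_coe.restrict F'.integrable_coe.restrict]
        exact integral_congr_ae (ae_restrict_of_ae (coe_add_ae F F'))
      map_smul' := fun c F => by
        rw [RingHom.id_apply, ← integral_smul]
        exact integral_congr_ae (ae_restrict_of_ae (coe_smul_ae c F)) } 1
    (fun F => by
      rw [one_mul, norm_eq_integral]
      exact (norm_integral_le_integral_norm _).trans
        (setIntegral_le_integral F.integrable_coe.norm (Eventually.of_forall fun _ => norm_nonneg _)))
  have h1 : T (f * g) = ∫ y, T (lmul (f y) (translate y g)) ∂μ :=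
    (T.integral_comp_comm (integrable_conv_integrand f.integrable_coe g)).symm
  refine h1.trans (integral_congr_ae (Eventually.of_forall fun y => ?_))
  have hi : Integrable (fun x => translate y g x) (μ.restrict s) :=
    (translate y g).integrable_coe.restrict
  calc ∫ x in s, lmul (f y) (translate y g) x ∂μ
      = ∫ x in s, f y * translate y g x ∂μ :=
        integral_congr_ae (ae_restrict_of_ae (lmul_ae (f y) (translate y g)))
    _ = f y * ∫ x in s, translate y g x ∂μ :=
        (ContinuousLinearMap.mul ℂ A (f y)).integral_comp_comm hi
    _ = f y * ∫ x in s, g (y⁻¹ * x) ∂μ := by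
        rw [integral_congr_ae (ae_restrict_of_ae (translate_ae y g))]

end Convolution

end GroupL1

/-! ### BED algebras -/

section BED

variable (B : Type*) [NonUnitalNormedRing B] [NormedSpace ℂ B]

/-- A commutative Banach algebra is semisimple if the kernels of its characters intersect in `0`,
i.e. if its Gelfand homomorphism is injective. -/
def IsGelfandSemisimple : Prop :=
  ∀ a : B, (∀ φ : characterSpace ℂ B, φ a = 0) → a = 0

/-- The image of `B` under the Gelfand homomorphism, as a set of functions on `Δ(B)`. -/
def gelfandImage : Set (characterSpace ℂ B → ℂ) :=
  Set.range fun (a : B) (φ : characterSpace ℂ B) => φ a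

/-- The BSE-functions on `Δ(B)`. -/
def bseFunctions : Set (characterSpace ℂ B → ℂ) :=
  {σ | Continuous σ ∧ (∃ M : ℝ, ∀ φ, ‖σ φ‖ ≤ M) ∧
    ∃ β : ℝ, 0 < β ∧ ∀ (n : ℕ) (c : Fin n → ℂ) (φ : Fin n → characterSpace ℂ B),
      ‖∑ i, c i * σ (φ i)‖ ≤ β * ‖∑ i, c i • CharacterSpace.toCLM (φ i)‖}

/-- The BED-functions on `Δ(B)`. -/
def bedFunctions : Set (characterSpace ℂ B → ℂ) :=
  {σ | σ ∈ bseFunctions B ∧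
    ∀ ε : ℝ, 0 < ε → ∃ K : Set (characterSpace ℂ B), IsCompact K ∧
      ∀ (n : ℕ) (c : Fin n → ℂ) (φ : Fin n → characterSpace ℂ B), (∀ i, φ i ∉ K) →
        ‖∑ i, c i * σ (φ i)‖ ≤ ε * ‖∑ i, c i • CharacterSpace.toCLM (φ i)‖}

/-- A BED algebra: a commutative Banach algebra with non-empty character space on which the
BED-functions are exactly the Gelfand transforms. -/
def IsBED : Prop :=
  (∀ x y : B, x * y = y * x) ∧ Nonempty (characterSpace ℂ B) ∧
    bedFunctions B = gelfandImage B

end BED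

open scoped BoundedContinuousFunction

/-! When `L¹(G, A)` is commutative, its characters are exactly the products (γ, φ) : f ↦ ∫ φ(f y)
γ(y) dy of a bounded continuous character γ of `G` and a character φ of `A` (`exists_prodChar_eq`,
`prodChar_inj`). Both inclusions for `A` are read off along the trivial γ = 1, where the product is
φ composed with f ↦ ∫ f.

Let σ be a BED-function on Δ(A) and s a set of positive finite measure. If (γ, φ) ↦ (∫ₛ γ) σ(φ) is a
BED-function, it is the transform of some F, and γ = 1 gives μ(s) σ(φ) = φ(∫ F), so σ is a Gelfand
transform.

The crux is therefore `setIntegral_mul_mem_bedFunctions`. Fix φ₀. Applying the BED property of one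
transform 1ₛ·a₀ to the characters (γ, φ₀) shows that L = ∫ₛ has small norm on the span of those γ
with (γ, φ₀) outside a compact K₁. A Hahn–Banach extension Λ of this restriction splits L = Λ + (L -
Λ): the first term is small everywhere, and the second vanishes on those γ, so that only the BED
estimate of σ outside a compact K₂ is needed. Both terms are controlled because ‖∑ cᵢ (γᵢ, φᵢ)‖
dominates ‖∑ cᵢ γᵢ(y) φᵢ‖ for every y (`norm_sum_smul_apply_le`). -/

/-! ### Characters of a normed algebra, and local averages on `G`. -/

theorem WeakDual.CharacterSpace.norm_toCLM_le_one {B : Type*} [NonUnitalNormedRing B]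
    [NormedSpace ℂ B] (φ : characterSpace ℂ B) : ‖CharacterSpace.toCLM φ‖ ≤ 1 := by
  set T := CharacterSpace.toCLM φ with hT
  -- Multiplicativity at x * x gives |T x|² ≤ ‖T‖ ‖x‖²; the resulting bound excludes ‖T‖ > 1.
  have h1 : ‖T‖ ≤ √‖T‖ := by
    refine T.opNorm_le_bound (Real.sqrt_nonneg _) fun x => ?_
    have h2 : ‖T x‖ ^ 2 ≤ ‖T‖ * ‖x‖ ^ 2 := by
      have h3 : T (x * x) = T x * T x := φ.prop.2 x x
      rw [← norm_pow, sq, ← h3, sq]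
      exact (T.le_opNorm _).trans (mul_le_mul_of_nonneg_left (norm_mul_le _ _) (norm_nonneg _))
    calc ‖T x‖ = √(‖T x‖ ^ 2) := (Real.sqrt_sq (norm_nonneg _)).symm
      _ ≤ √(‖T‖ * ‖x‖ ^ 2) := Real.sqrt_le_sqrt h2
      _ = √‖T‖ * ‖x‖ := by rw [Real.sqrt_mul (norm_nonneg _), Real.sqrt_sq (norm_nonneg _)]
  by_contra! h
  have h4 := Real.sq_sqrt (norm_nonneg T)
  nlinarith [Real.sqrt_nonneg ‖T‖]

theorem WeakDual.CharacterSpace.exists_apply_ne_zero {B : Type*} [NonUnitalNormedRing B]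
    [NormedSpace ℂ B] (φ : characterSpace ℂ B) : ∃ b : B, φ b ≠ 0 := by
  by_contra! h
  exact φ.prop.1 (DFunLike.ext _ _ h)

theorem WeakDual.CharacterSpace.continuous_eval {B : Type*} [NonUnitalNormedRing B]
    [NormedSpace ℂ B] (b : B) : Continuous fun φ : characterSpace ℂ B => φ b :=
  (WeakDual.eval_continuous b).comp continuous_subtype_val

theorem WeakDual.CharacterSpace.continuous_of_eval {B : Type*} [NonUnitalNormedRing B]
    [NormedSpace ℂ B] {X : Type*} [TopologicalSpace X] {F : X → characterSpace ℂ B}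
    (h : ∀ b, Continuous fun x => F x b) : Continuous F :=
  continuous_induced_rng.2 (WeakDual.continuous_of_continuous_eval h)

/-- The value of a continuous function at a point is approximated by its averages over sets of
positive finite measure. -/
theorem exists_setIntegral_close {G : Type*} [TopologicalSpace G] [MeasurableSpace G]
    [BorelSpace G] (μ : Measure G) [IsLocallyFiniteMeasure μ] [μ.IsOpenPosMeasure]
    (h : G →ᵇ ℂ) (y : G) {ε : ℝ} (hε : 0 < ε) :
    ∃ s : Set G, MeasurableSet s ∧ μ s ≠ ∞ ∧ 0 < μ.real s ∧
      ‖∫ x in s, h x ∂μ - μ.real s * h y‖ ≤ ε * μ.real s := by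
  obtain ⟨u, hyu, huo, hu⟩ := μ.exists_isOpen_measure_lt_top y
  have hv : IsOpen {x | ‖h x - h y‖ < ε} :=
    isOpen_lt (by fun_prop) continuous_const
  set s := u ∩ {x | ‖h x - h y‖ < ε} with hs
  have hso : IsOpen s := huo.inter hv
  have hys : y ∈ s := ⟨hyu, by simpa using hε⟩
  have hμs : μ s < ∞ := (measure_mono Set.inter_subset_left).trans_lt hu
  refine ⟨s, hso.measurableSet, hμs.ne,
    ENNReal.toReal_pos (hso.measure_pos μ ⟨y, hys⟩).ne' hμs.ne, ?_⟩
  have hi : IntegrableOn (fun x => h x) s μ :=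
    Measure.integrableOn_of_bounded hμs.ne h.continuous.measurable.aestronglyMeasurable
      (Eventually.of_forall h.norm_coe_le_norm)
  have hc : IntegrableOn (fun _ => h y) s μ := integrableOn_const hμs.ne
  have h1 : ∫ x in s, h x ∂μ - μ.real s * h y = ∫ x in s, (h x - h y) ∂μ := by
    rw [integral_sub hi hc, setIntegral_const]
    simp
  rw [h1]
  exact norm_setIntegral_le_of_norm_le_const hμs fun x hx => le_of_lt hx.2

namespace GroupL1

/-! ### Indicator elements and the pairing of `L¹(G, A)` with functions on `G` and functionals on
`A`. -/

section Elementary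

variable {G : Type*} [MeasurableSpace G] {A : Type*} [NormedAddCommGroup A] {μ : Measure G}

/-- The function `x ↦ 1ₛ(x) a` in `L¹(G, A)`. -/
noncomputable def ind {s : Set G} (hs : MeasurableSet s) (hμs : μ s ≠ ∞) (a : A) : GroupL1 A μ :=
  indicatorConstLp 1 hs hμs a

theorem ind_ae {s : Set G} (hs : MeasurableSet s) (hμs : μ s ≠ ∞) (a : A) :
    ∀ᵐ x ∂μ, ind hs hμs a x = s.indicator (fun _ => a) x :=
  indicatorConstLp_coeFn

theorem norm_ind {s : Set G} (hs : MeasurableSet s) (hμs : μ s ≠ ∞) (a : A) :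
    ‖ind hs hμs a‖ = ‖a‖ * μ.real s := by
  refine (norm_indicatorConstLp one_ne_zero ENNReal.one_ne_top).trans ?_
  simp

end Elementary

section Pairing

variable {G : Type*} [TopologicalSpace G] [MeasurableSpace G] [BorelSpace G]
  {A : Type*} [NormedAddCommGroup A] [NormedSpace ℂ A] {μ : Measure G}

theorem integrable_pairing (γ : G →ᵇ ℂ) (φ : A →L[ℂ] ℂ) (f : GroupL1 A μ) :
    Integrable (fun y => φ (f y) * γ y) μ :=
  (φ.integrable_comp f.integrable_coe).mul_bdd γ.continuous.measurable.aestronglyMeasurable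
    (Eventually.of_forall γ.norm_coe_le_norm)

/-- The functional `f ↦ ∫ φ (f y) * γ y dμ y` on `L¹(G, A)`. -/
noncomputable def pairing (μ : Measure G) (γ : G →ᵇ ℂ) (φ : A →L[ℂ] ℂ) : GroupL1 A μ →L[ℂ] ℂ :=
  LinearMap.mkContinuous
    { toFun := fun f => ∫ y, φ (f y) * γ y ∂μ
      map_add' := fun f g => by
        rw [← integral_add (integrable_pairing γ φ f) (integrable_pairing γ φ g)]
        apply integral_congr_ae
        filter_upwards [coe_add_ae f g] with y hy
        rw [hy, map_add, add_mul]
      map_smul' := fun c f => by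
        rw [RingHom.id_apply, ← integral_smul]
        apply integral_congr_ae
        filter_upwards [coe_smul_ae c f] with y hy
        rw [hy, map_smul, smul_mul_assoc] } (‖φ‖ * ‖γ‖)
    (fun f => by
      rw [norm_eq_integral, ← integral_const_mul]
      refine norm_integral_le_of_norm_le (f.integrable_coe.norm.const_mul _)
        (Eventually.of_forall fun y => ?_)
      rw [norm_mul, mul_right_comm]
      exact mul_le_mul (φ.le_opNorm _) (γ.norm_coe_le_norm y) (norm_nonneg _) (by positivity))

theorem pairing_apply (γ : G →ᵇ ℂ) (φ : A →L[ℂ] ℂ) (f : GroupL1 A μ) :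
    pairing μ γ φ f = ∫ y, φ (f y) * γ y ∂μ := rfl

theorem pairing_ind (γ : G →ᵇ ℂ) (φ : A →L[ℂ] ℂ) {s : Set G} (hs : MeasurableSet s)
    (hμs : μ s ≠ ∞) (a : A) : pairing μ γ φ (ind hs hμs a) = φ a * ∫ x in s, γ x ∂μ := by
  rw [pairing_apply, ← integral_const_mul, ← integral_indicator hs]
  apply integral_congr_ae
  filter_upwards [ind_ae hs hμs a] with x hx
  rw [hx]
  by_cases h : x ∈ s <;> simp [h]

end Pairing

/-! ### Characters of `L¹(G, A)` are products. -/

section Character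

set_option linter.unusedSectionVars false

variable {G : Type*} [Group G] [TopologicalSpace G] [IsTopologicalGroup G] [T2Space G]
  [MeasurableSpace G] [BorelSpace G]
  {A : Type*} [NonUnitalNormedRing A] [NormedSpace ℂ A]
  [IsScalarTower ℂ A A] [SMulCommClass ℂ A A]
  {μ : Measure G} [μ.IsMulLeftInvariant]

variable (G) in
/-- The bounded continuous characters `G → ℂ`. -/
structure BddChar where
  /-- The underlying bounded continuous function. -/
  toBCF : G →ᵇ ℂ
  map_one : toBCF 1 = 1
  map_mul : ∀ y z, toBCF (y * z) = toBCF y * toBCF z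

theorem pairing_lmul (γ : G →ᵇ ℂ) (φ : characterSpace ℂ A) (a : A) (f : GroupL1 A μ) :
    pairing μ γ (CharacterSpace.toCLM φ) (lmul a f) =
      φ a * pairing μ γ (CharacterSpace.toCLM φ) f := by
  rw [pairing_apply, pairing_apply, ← integral_const_mul]
  apply integral_congr_ae
  filter_upwards [lmul_ae a f] with y hy
  rw [hy, CharacterSpace.coe_toCLM, map_mul, mul_assoc]

theorem pairing_translate (γ : BddChar G) (φ : A →L[ℂ] ℂ) (y : G) (f : GroupL1 A μ) :
    pairing μ γ.toBCF φ (translate y f) = γ.toBCF y * pairing μ γ.toBCF φ f := by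
  rw [pairing_apply, pairing_apply, ← integral_const_mul,
    ← integral_mul_left_eq_self _ y]
  apply integral_congr_ae
  filter_upwards [ae_mul_left y (translate_ae y f)] with x hx
  rw [hx, inv_mul_cancel_left, γ.map_mul]
  ring

variable [IsLocallyFiniteMeasure μ] [μ.InnerRegularCompactLTTop] [CompleteSpace A]

/-- The product is a Bochner integral of the elements f(y) · τ_y g, so the functional passes under
the integral, where multiplication by f(y) and translation by y contribute the factors φ(f y) and
γ(y). -/
theorem pairing_mul (γ : BddChar G) (φ : characterSpace ℂ A) (f g : GroupL1 A μ) :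
    pairing μ γ.toBCF (CharacterSpace.toCLM φ) (f * g) =
      pairing μ γ.toBCF (CharacterSpace.toCLM φ) f *
        pairing μ γ.toBCF (CharacterSpace.toCLM φ) g := by
  rw [mul_def, ← (pairing μ γ.toBCF (CharacterSpace.toCLM φ)).integral_comp_comm
    (integrable_conv_integrand f.integrable_coe g)]
  simp only [pairing_lmul, pairing_translate]
  rw [pairing_apply _ _ f, ← integral_mul_const]
  simp only [CharacterSpace.coe_toCLM, mul_assoc]

theorem pairing_ne_zero [μ.IsOpenPosMeasure] (γ : BddChar G) (φ : characterSpace ℂ A) :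
    pairing μ γ.toBCF (CharacterSpace.toCLM φ) ≠ 0 := by
  intro h0
  obtain ⟨a, ha⟩ := CharacterSpace.exists_apply_ne_zero φ
  -- Since γ(1) = 1, ∫ₛ γ lies within μ(s)/2 of μ(s) and cannot vanish.
  obtain ⟨s, hs, hμs, hpos, hsε⟩ :=
    exists_setIntegral_close μ γ.toBCF 1 (ε := 1 / 2) (by norm_num)
  have h1 := pairing_ind γ.toBCF (CharacterSpace.toCLM φ) hs hμs a
  rw [h0, zero_apply, CharacterSpace.coe_toCLM, eq_comm, mul_eq_zero] at h1
  rw [h1.resolve_left ha, γ.map_one, zero_sub, norm_neg, mul_one, Complex.norm_real,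
    Real.norm_of_nonneg hpos.le] at hsε
  linarith

/-- The character `f ↦ ∫ φ (f y) * γ y dμ y` of `L¹(G, A)`. -/
noncomputable def prodChar (μ : Measure G) [μ.IsMulLeftInvariant] [IsLocallyFiniteMeasure μ]
    [μ.InnerRegularCompactLTTop] [μ.IsOpenPosMeasure] (γ : BddChar G) (φ : characterSpace ℂ A) :
    characterSpace ℂ (GroupL1 A μ) :=
  ⟨StrongDual.toWeakDual (pairing μ γ.toBCF (CharacterSpace.toCLM φ)),
    fun h => pairing_ne_zero (μ := μ) γ φ h, pairing_mul γ φ⟩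

variable [μ.IsOpenPosMeasure]

theorem toCLM_prodChar (γ : BddChar G) (φ : characterSpace ℂ A) :
    CharacterSpace.toCLM (prodChar μ γ φ) = pairing μ γ.toBCF (CharacterSpace.toCLM φ) := rfl

theorem prodChar_apply (γ : BddChar G) (φ : characterSpace ℂ A) (f : GroupL1 A μ) :
    prodChar μ γ φ f = ∫ y, φ (f y) * γ.toBCF y ∂μ := rfl

theorem prodChar_ind (γ : BddChar G) (φ : characterSpace ℂ A) {s : Set G} (hs : MeasurableSet s)
    (hμs : μ s ≠ ∞) (a : A) :
    prodChar μ γ φ (ind hs hμs a) = φ a * ∫ x in s, γ.toBCF x ∂μ :=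
  pairing_ind _ _ hs hμs a

theorem prodChar_lmul (γ : BddChar G) (φ : characterSpace ℂ A) (a : A) (f : GroupL1 A μ) :
    prodChar μ γ φ (lmul a f) = φ a * prodChar μ γ φ f :=
  pairing_lmul _ _ a f

theorem prodChar_translate (γ : BddChar G) (φ : characterSpace ℂ A) (y : G) (f : GroupL1 A μ) :
    prodChar μ γ φ (translate y f) = γ.toBCF y * prodChar μ γ φ f :=
  pairing_translate γ _ y f

/-- Both factors are recovered as quotients: γ(y) = Φ(τ_y f)/Φ(f) and φ(a) = Φ(a·f)/Φ(f) whenever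
Φ(f) ≠ 0. -/
theorem prodChar_inj {γ γ' : BddChar G} {φ φ' : characterSpace ℂ A}
    (h : prodChar μ γ φ = prodChar μ γ' φ') : γ = γ' ∧ φ = φ' := by
  obtain ⟨f, hf⟩ := CharacterSpace.exists_apply_ne_zero (prodChar μ γ φ)
  constructor
  · have : γ.toBCF = γ'.toBCF := by
      ext y
      have h1 := prodChar_translate γ φ y f
      rw [h, prodChar_translate, ← h] at h1
      exact (mul_right_cancel₀ hf h1).symm
    cases γ; cases γ'; cases this; rfl
  · ext a
    have h1 := prodChar_lmul γ φ a f
    rw [h, prodChar_lmul, ← h] at h1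
    exact (mul_right_cancel₀ hf h1).symm

theorem lmul_mul (a : A) (f g : GroupL1 A μ) : lmul a (f * g) = lmul a f * g :=
  lmul_conv a f g

theorem translate_mul (y : G) (f g : GroupL1 A μ) : translate y (f * g) = translate y f * g :=
  translate_conv y f g

/-- Every character of a commutative `L¹(G, A)` is the product of a character of `G` and a
character of `A`. -/
theorem exists_prodChar_eq (hcomm : ∀ f g : GroupL1 A μ, f * g = g * f)
    (Φ : characterSpace ℂ (GroupL1 A μ)) : ∃ γ φ, prodChar μ γ φ = Φ := by
  obtain ⟨f₀, hf₀⟩ := CharacterSpace.exists_apply_ne_zero Φ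
  -- By commutativity Φ(a·(f * f₀)) is symmetric in f and f₀, so Φ(a·f)/Φ(f) does not depend on f.
  -- The same holds for translations below.
  have hl : ∀ (a : A) (f : GroupL1 A μ), Φ (lmul a f) = Φ (lmul a f₀) / Φ f₀ * Φ f := by
    intro a f
    have h1 : Φ (lmul a f) * Φ f₀ = Φ (lmul a f₀) * Φ f := by
      rw [← map_mul, ← map_mul, ← lmul_mul, ← lmul_mul, hcomm]
    field_simp
    exact h1
  have ht : ∀ (y : G) (f : GroupL1 A μ),
      Φ (translate y f) = Φ (translate y f₀) / Φ f₀ * Φ f := by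
    intro y f
    have h1 : Φ (translate y f) * Φ f₀ = Φ (translate y f₀) * Φ f := by
      rw [← map_mul, ← map_mul, ← translate_mul, ← translate_mul, hcomm]
    field_simp
    exact h1
  let T : A →L[ℂ] ℂ :=
    (Φ f₀)⁻¹ • (CharacterSpace.toCLM Φ).comp ((lmulL A μ).flip f₀)
  have hT : ∀ a, T a = Φ (lmul a f₀) / Φ f₀ := fun a => by
    change (Φ f₀)⁻¹ * Φ (lmul a f₀) = _
    rw [div_eq_inv_mul]
  let γ : G →ᵇ ℂ := BoundedContinuousFunction.ofNormedAddCommGroup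
    (fun y => Φ (translate y f₀) / Φ f₀)
    (((map_continuous Φ).comp (continuous_translate f₀)).div_const _) (‖f₀‖ / ‖Φ f₀‖)
    (fun y => by
      rw [norm_div]
      gcongr
      have h1 := (CharacterSpace.toCLM Φ).le_of_opNorm_le
        (CharacterSpace.norm_toCLM_le_one Φ) (translate y f₀)
      rwa [norm_translate, one_mul] at h1)
  have hγ : ∀ y, γ y = Φ (translate y f₀) / Φ f₀ := fun y => rfl
  -- Apply Φ to f * f₀ under the integral sign and cancel Φ(f₀).
  have key : ∀ f : GroupL1 A μ, Φ f = ∫ y, T (f y) * γ y ∂μ := by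
    intro f
    have h1 : Φ f * Φ f₀ = ∫ y, Φ (lmul (f y) (translate y f₀)) ∂μ := by
      rw [← map_mul, mul_def]
      exact ((CharacterSpace.toCLM Φ).integral_comp_comm
        (integrable_conv_integrand f.integrable_coe f₀)).symm
    have h2 : ∀ y, Φ (lmul (f y) (translate y f₀)) = T (f y) * γ y * Φ f₀ := by
      intro y
      rw [hl, ht, hT, hγ, mul_assoc]
    simp only [h2, integral_mul_const] at h1
    exact mul_right_cancel₀ hf₀ h1
  have hT0 : T ≠ 0 := by
    intro h0
    apply hf₀
    rw [key, h0]
    simp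
  have hTm : ∀ a b, T (a * b) = T a * T b := by
    intro a b
    rw [hT, ← lmul_lmul, hl, ← hT, mul_div_assoc, ← hT]
  let φ : characterSpace ℂ A := ⟨StrongDual.toWeakDual T, fun h => hT0 h, hTm⟩
  have htr1 : translate 1 f₀ = f₀ := by
    apply ext_ae
    filter_upwards [translate_ae 1 f₀] with x hx
    rw [hx, inv_one, one_mul]
  refine ⟨⟨γ, by rw [hγ, htr1, div_self hf₀], fun y z => ?_⟩, φ, ?_⟩
  · rw [hγ, ← translate_translate, ht, ← hγ, mul_div_assoc, ← hγ]
  · ext f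
    exact (key f).symm

end Character

end GroupL1

/-! ### General facts on the BSE and BED inequalities. -/

theorem Finset.sum_equivFin_of_eq_zero {ι E : Type*} [Fintype ι] [AddCommMonoid E] (S : Finset ι)
    (f : ι → E) (hf : ∀ i ∉ S, f i = 0) : ∑ j, f (S.equivFin.symm j) = ∑ i, f i := by
  rw [Equiv.sum_comp S.equivFin.symm fun i : S => f i, Finset.sum_coe_sort S f]
  exact Finset.sum_subset (Finset.subset_univ _) fun i _ hi => hf i hi

/-- In an estimate for characters outside `K`, characters in `K` may occur with coefficient `0`. -/
theorem norm_sum_le_of_coeff_eq_zero {B : Type*} [NonUnitalNormedRing B] [NormedSpace ℂ B]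
    {σ : characterSpace ℂ B → ℂ} {K : Set (characterSpace ℂ B)} {ε : ℝ}
    (hK : ∀ (n : ℕ) (c : Fin n → ℂ) (φ : Fin n → characterSpace ℂ B), (∀ i, φ i ∉ K) →
        ‖∑ i, c i * σ (φ i)‖ ≤ ε * ‖∑ i, c i • CharacterSpace.toCLM (φ i)‖)
    {n : ℕ} (c : Fin n → ℂ) (φ : Fin n → characterSpace ℂ B) (hc : ∀ i, φ i ∈ K → c i = 0) :
    ‖∑ i, c i * σ (φ i)‖ ≤ ε * ‖∑ i, c i • CharacterSpace.toCLM (φ i)‖ := by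
  classical
  set S : Finset (Fin n) := Finset.univ.filter fun i => φ i ∉ K with hS
  have hcS : ∀ i ∉ S, c i = 0 := fun i hi => hc i (by simpa [hS] using hi)
  have h := hK S.card (fun j => c (S.equivFin.symm j)) (fun j => φ (S.equivFin.symm j))
    fun j => (Finset.mem_filter.1 (S.equivFin.symm j).2).2
  rwa [S.sum_equivFin_of_eq_zero (fun i => c i * σ (φ i)) fun i hi => by rw [hcS i hi, zero_mul],
    S.sum_equivFin_of_eq_zero (fun i => c i • CharacterSpace.toCLM (φ i))
      fun i hi => by rw [hcS i hi]; exact ContinuousLinearMap.ext fun x => zero_mul _] at h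

theorem gelfandImage_subset_bseFunctions (B : Type*) [NonUnitalNormedRing B] [NormedSpace ℂ B] :
    gelfandImage B ⊆ bseFunctions B := by
  rintro _ ⟨a, rfl⟩
  -- The summand 1 only serves to make the BSE constant positive when a = 0.
  refine ⟨CharacterSpace.continuous_eval a, ⟨‖a‖, fun φ => ?_⟩, ‖a‖ + 1, by positivity,
    fun n c φ => ?_⟩
  · simpa using (CharacterSpace.toCLM φ).le_of_opNorm_le (CharacterSpace.norm_toCLM_le_one φ) a
  · have h := (∑ i, c i • CharacterSpace.toCLM (φ i)).le_opNorm a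
    simp only [sum_apply, smul_apply,
      CharacterSpace.coe_toCLM, smul_eq_mul] at h
    rw [mul_comm] at h
    exact h.trans (mul_le_mul_of_nonneg_right (by linarith) (norm_nonneg _))

namespace GroupL1

/-! ### Integration functionals on bounded continuous functions. -/

section SetIntegral

variable {G : Type*} [TopologicalSpace G] [MeasurableSpace G] [BorelSpace G]

/-- Integration over a set of finite measure, as a functional on bounded continuous functions. -/
noncomputable def setIntegralCLM (μ : Measure G) {s : Set G} (hμs : μ s ≠ ∞) : (G →ᵇ ℂ) →L[ℂ] ℂ :=
  have hi : ∀ h : G →ᵇ ℂ, IntegrableOn (fun x => h x) s μ := fun h =>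
    Measure.integrableOn_of_bounded hμs h.continuous.measurable.aestronglyMeasurable
      (Eventually.of_forall h.norm_coe_le_norm)
  LinearMap.mkContinuous
    { toFun := fun h => ∫ x in s, h x ∂μ
      map_add' := fun h k => integral_add (hi h) (hi k)
      map_smul' := fun c h => integral_smul c fun x => h x } (μ.real s)
    (fun h => by
      rw [mul_comm]
      exact norm_setIntegral_le_of_norm_le_const hμs.lt_top fun x _ => h.norm_coe_le_norm x)

theorem setIntegralCLM_apply (μ : Measure G) {s : Set G} (hμs : μ s ≠ ∞) (h : G →ᵇ ℂ) :
    setIntegralCLM μ hμs h = ∫ x in s, h x ∂μ := rfl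

variable {A : Type*} [NormedAddCommGroup A] [NormedSpace ℂ A] {μ : Measure G}

theorem norm_pairing_le (γ : G →ᵇ ℂ) (φ : A →L[ℂ] ℂ) : ‖pairing μ γ φ‖ ≤ ‖φ‖ * ‖γ‖ :=
  LinearMap.mkContinuous_norm_le _ (by positivity) _

theorem pairing_sum {n : ℕ} (c : Fin n → ℂ) (γ : Fin n → G →ᵇ ℂ) (φ : A →L[ℂ] ℂ) :
    pairing μ (∑ i, c i • γ i) φ = ∑ i, c i • pairing μ (γ i) φ := by
  ext f
  simp only [sum_apply, smul_apply, pairing_apply,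
    ← integral_smul]
  rw [← integral_finsetSum]
  swap
  · exact fun i _ => (integrable_pairing (γ i) φ f).smul (c i)
  congr 1
  ext y
  simp [Finset.mul_sum, mul_left_comm]

end SetIntegral

/-! ### Norm estimates and continuity for the product decomposition, and the transfer of
BED-functions. -/

section BED

set_option linter.unusedSectionVars false

variable {G : Type*} [Group G] [TopologicalSpace G] [IsTopologicalGroup G] [T2Space G]
  [MeasurableSpace G] [BorelSpace G]
  {A : Type*} [NonUnitalNormedRing A] [NormedSpace ℂ A]
  [IsScalarTower ℂ A A] [SMulCommClass ℂ A A] [CompleteSpace A]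
  {μ : Measure G} [μ.IsMulLeftInvariant] [IsLocallyFiniteMeasure μ] [μ.InnerRegularCompactLTTop]
  [μ.IsOpenPosMeasure]

/-- Test the functional on 1ₛ·a, of norm ‖a‖ μ(s), where s is so small around y that the average
over s of ∑ cᵢ φᵢ(a) γᵢ is close to its value at y. -/
theorem norm_sum_apply_le {n : ℕ} (c : Fin n → ℂ) (γ : Fin n → BddChar G)
    (φ : Fin n → characterSpace ℂ A) (y : G) (a : A) :
    ‖∑ i, c i * (γ i).toBCF y * φ i a‖ ≤
      ‖∑ i, c i • CharacterSpace.toCLM (prodChar μ (γ i) (φ i))‖ * ‖a‖ := by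
  set P := ∑ i, c i • CharacterSpace.toCLM (prodChar μ (γ i) (φ i)) with hP
  let h : G →ᵇ ℂ := ∑ i, (c i * φ i a) • (γ i).toBCF
  have hh : ∀ x, h x = ∑ i, c i * (γ i).toBCF x * φ i a := fun x => by
    simp [h, mul_right_comm]
  refine le_of_forall_pos_le_add fun ε hε => ?_
  obtain ⟨s, hs, hμs, hpos, hsε⟩ := exists_setIntegral_close μ h y hε
  have h1 : P (ind hs hμs a) = ∫ x in s, h x ∂μ := by
    rw [← setIntegralCLM_apply μ hμs]
    simp only [hP, h, map_sum, map_smul, sum_apply,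
      smul_apply, CharacterSpace.coe_toCLM, prodChar_ind,
      setIntegralCLM_apply, smul_eq_mul, mul_assoc]
  have h2 : ‖∫ x in s, h x ∂μ‖ ≤ ‖P‖ * (‖a‖ * μ.real s) := by
    rw [← h1, ← norm_ind hs hμs a]
    exact P.le_opNorm _
  have h3 : ‖(μ.real s : ℂ) * h y‖ ≤ ‖P‖ * (‖a‖ * μ.real s) + ε * μ.real s := by
    have := norm_sub_le (∫ x in s, h x ∂μ) (∫ x in s, h x ∂μ - μ.real s * h y)
    rw [sub_sub_cancel] at this
    linarith
  rw [norm_mul, Complex.norm_real, Real.norm_of_nonneg hpos.le] at h3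
  rw [← hh]
  refine le_of_mul_le_mul_left ?_ hpos
  linarith

theorem norm_sum_smul_apply_le {n : ℕ} (c : Fin n → ℂ) (γ : Fin n → BddChar G)
    (φ : Fin n → characterSpace ℂ A) (y : G) :
    ‖∑ i, (c i * (γ i).toBCF y) • CharacterSpace.toCLM (φ i)‖ ≤
      ‖∑ i, c i • CharacterSpace.toCLM (prodChar μ (γ i) (φ i))‖ :=
  ContinuousLinearMap.opNorm_le_bound _ (norm_nonneg _) fun a => by
    simpa using norm_sum_apply_le (μ := μ) c γ φ y a

/-- Evaluated at a, the left side is Λ of the function ∑ cᵢ φᵢ(a) γᵢ, whose sup norm is bounded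
pointwise by `norm_sum_apply_le`. -/
theorem norm_sum_smul_functional_le (Λ : (G →ᵇ ℂ) →L[ℂ] ℂ) {n : ℕ} (c : Fin n → ℂ)
    (γ : Fin n → BddChar G) (φ : Fin n → characterSpace ℂ A) :
    ‖∑ i, (c i * Λ (γ i).toBCF) • CharacterSpace.toCLM (φ i)‖ ≤
      ‖Λ‖ * ‖∑ i, c i • CharacterSpace.toCLM (prodChar μ (γ i) (φ i))‖ := by
  refine ContinuousLinearMap.opNorm_le_bound _ (by positivity) fun a => ?_
  have h1 : (∑ i, (c i * Λ (γ i).toBCF) • CharacterSpace.toCLM (φ i)) a =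
      Λ (∑ i, (c i * φ i a) • (γ i).toBCF) := by
    simp [sum_apply, mul_right_comm]
  rw [h1, mul_assoc]
  refine Λ.le_opNorm_of_le ((BoundedContinuousFunction.norm_le (by positivity)).2 fun y => ?_)
  simpa [mul_right_comm] using norm_sum_apply_le (μ := μ) c γ φ y a

/-- Here Λ acts on ∑ cᵢ σ(φᵢ) γᵢ; at each y the BSE inequality of σ with coefficients cᵢ γᵢ(y)
bounds its value. -/
theorem norm_sum_functional_mul_le (Λ : (G →ᵇ ℂ) →L[ℂ] ℂ) {σ : characterSpace ℂ A → ℂ} {β : ℝ}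
    (hβ : 0 < β)
    (hσ : ∀ (n : ℕ) (c : Fin n → ℂ) (φ : Fin n → characterSpace ℂ A),
      ‖∑ i, c i * σ (φ i)‖ ≤ β * ‖∑ i, c i • CharacterSpace.toCLM (φ i)‖)
    {n : ℕ} (c : Fin n → ℂ) (γ : Fin n → BddChar G) (φ : Fin n → characterSpace ℂ A) :
    ‖∑ i, c i * (Λ (γ i).toBCF * σ (φ i))‖ ≤
      ‖Λ‖ * β * ‖∑ i, c i • CharacterSpace.toCLM (prodChar μ (γ i) (φ i))‖ := by
  have h1 : ∑ i, c i * (Λ (γ i).toBCF * σ (φ i)) = Λ (∑ i, (c i * σ (φ i)) • (γ i).toBCF) := by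
    simp [mul_assoc, mul_comm (σ _)]
  rw [h1, mul_assoc]
  refine Λ.le_opNorm_of_le ((BoundedContinuousFunction.norm_le (by positivity)).2 fun y => ?_)
  refine le_trans ?_ ((hσ n (fun i => c i * (γ i).toBCF y) φ).trans
    (mul_le_mul_of_nonneg_left (norm_sum_smul_apply_le (μ := μ) c γ φ y) hβ.le))
  simp [mul_right_comm]

variable (hcomm : ∀ f g : GroupL1 A μ, f * g = g * f)

/-- The group component of a character of `L¹(G, A)`. -/
noncomputable def groupPart (Φ : characterSpace ℂ (GroupL1 A μ)) : BddChar G :=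
  (exists_prodChar_eq hcomm Φ).choose

/-- The algebra component of a character of `L¹(G, A)`. -/
noncomputable def algPart (Φ : characterSpace ℂ (GroupL1 A μ)) : characterSpace ℂ A :=
  (exists_prodChar_eq hcomm Φ).choose_spec.choose

theorem prodChar_parts (Φ : characterSpace ℂ (GroupL1 A μ)) :
    prodChar μ (groupPart hcomm Φ) (algPart hcomm Φ) = Φ :=
  (exists_prodChar_eq hcomm Φ).choose_spec.choose_spec

theorem groupPart_prodChar (γ : BddChar G) (φ : characterSpace ℂ A) :
    groupPart hcomm (prodChar μ γ φ) = γ :=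
  (prodChar_inj (prodChar_parts hcomm (prodChar μ γ φ))).1

theorem algPart_prodChar (γ : BddChar G) (φ : characterSpace ℂ A) :
    algPart hcomm (prodChar μ γ φ) = φ :=
  (prodChar_inj (prodChar_parts hcomm (prodChar μ γ φ))).2

/-- Near Φ₀ the value at b is the quotient Φ(b·f)/Φ(f) of Gelfand transforms, for any f with Φ₀(f) ≠
0. -/
theorem continuous_algPart : Continuous (algPart hcomm) := by
  refine CharacterSpace.continuous_of_eval fun b => continuous_iff_continuousAt.2 fun Φ₀ => ?_
  obtain ⟨f, hf⟩ := CharacterSpace.exists_apply_ne_zero Φ₀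
  have hne : ∀ᶠ Φ : characterSpace ℂ (GroupL1 A μ) in 𝓝 Φ₀, Φ f ≠ 0 :=
    (CharacterSpace.continuous_eval f).continuousAt.eventually_ne hf
  refine ContinuousAt.congr (((CharacterSpace.continuous_eval (lmul b f)).continuousAt).div
    (CharacterSpace.continuous_eval f).continuousAt hf) ?_
  filter_upwards [hne] with Φ hΦ
  have h1 := prodChar_lmul (μ := μ) (groupPart hcomm Φ) (algPart hcomm Φ) b f
  rw [prodChar_parts] at h1
  rw [Pi.div_apply, h1, mul_div_cancel_right₀ _ hΦ]

theorem continuous_setIntegral_groupPart {s : Set G} (hs : MeasurableSet s) (hμs : μ s ≠ ∞) :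
    Continuous fun Φ => ∫ x in s, (groupPart hcomm Φ).toBCF x ∂μ := by
  refine continuous_iff_continuousAt.2 fun Φ₀ => ?_
  obtain ⟨b, hb⟩ := CharacterSpace.exists_apply_ne_zero (algPart hcomm Φ₀)
  have hcb : Continuous fun Φ => algPart hcomm Φ b :=
    (CharacterSpace.continuous_eval b).comp (continuous_algPart hcomm)
  refine ContinuousAt.congr
    (((CharacterSpace.continuous_eval (ind hs hμs b)).continuousAt).div hcb.continuousAt hb) ?_
  filter_upwards [hcb.continuousAt.eventually_ne hb] with Φ hΦ
  have h1 := prodChar_ind (μ := μ) (groupPart hcomm Φ) (algPart hcomm Φ) hs hμs b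
  rw [prodChar_parts] at h1
  rw [Pi.div_apply, h1, mul_div_cancel_left₀ _ hΦ]

theorem norm_character_sub_le (Φ : characterSpace ℂ (GroupL1 A μ)) (f g : GroupL1 A μ) :
    ‖Φ f - Φ g‖ ≤ ‖f - g‖ := by
  rw [← map_sub]
  simpa using (CharacterSpace.toCLM Φ).le_of_opNorm_le (CharacterSpace.norm_toCLM_le_one Φ) (f - g)

/-- This map recombines compact sets of group parts and of algebra parts without putting a topology
on `BddChar G`. For indicator elements continuity is explicit; it extends by density, characters
being contractive and hence the approximation uniform. -/
theorem continuous_prodChar_groupPart :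
    Continuous fun p : characterSpace ℂ (GroupL1 A μ) × characterSpace ℂ A =>
      prodChar μ (groupPart hcomm p.1) p.2 := by
  refine CharacterSpace.continuous_of_eval fun f => ?_
  refine Lp.induction ENNReal.one_ne_top
    (motive := fun f : Lp A 1 μ => Continuous
      fun p : characterSpace ℂ (GroupL1 A μ) × characterSpace ℂ A =>
        prodChar μ (groupPart hcomm p.1) p.2 (show GroupL1 A μ from f)) ?_ ?_ ?_ f
  · intro a s hs hμs
    have h1 : (Lp.simpleFunc.indicatorConst 1 hs hμs.ne a : Lp A 1 μ) = ind hs hμs.ne a :=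
      Lp.simpleFunc.coe_indicatorConst hs hμs.ne a
    rw [h1]
    change Continuous fun p : characterSpace ℂ (GroupL1 A μ) × characterSpace ℂ A =>
      prodChar μ (groupPart hcomm p.1) p.2 (ind hs hμs.ne a)
    simp only [prodChar_ind]
    exact ((CharacterSpace.continuous_eval a).comp continuous_snd).mul
      ((continuous_setIntegral_groupPart hcomm hs hμs.ne).comp continuous_fst)
  · intro f g hf hg _ h1 h2
    refine (h1.add h2).congr fun p => ?_
    exact (map_add (prodChar μ (groupPart hcomm p.1) p.2) (show GroupL1 A μ from hf.toLp f)
      (show GroupL1 A μ from hg.toLp g)).symm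
  · refine isClosed_of_closure_subset fun f hf => ?_
    refine continuous_of_uniform_approx_of_continuous fun u hu => ?_
    obtain ⟨ε, hε, hεu⟩ := Metric.mem_uniformity_dist.1 hu
    obtain ⟨g, hg, hfg⟩ := Metric.mem_closure_iff.1 hf ε hε
    refine ⟨_, hg, fun p => hεu ?_⟩
    rw [dist_eq_norm] at hfg ⊢
    exact (norm_character_sub_le _ _ _).trans_lt hfg

/-- The product of the Fourier transform of `1ₛ` with a BED-function on `Δ(A)` is a BED-function on
`Δ(L¹(G, A))`. -/
theorem setIntegral_mul_mem_bedFunctions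
    (hsub : gelfandImage (GroupL1 A μ) ⊆ bedFunctions (GroupL1 A μ))
    (hne : Nonempty (characterSpace ℂ A)) {σ : characterSpace ℂ A → ℂ} (hσ : σ ∈ bedFunctions A)
    {s : Set G} (hs : MeasurableSet s) (hμs : μ s ≠ ∞) :
    (fun Φ => (∫ x in s, (groupPart hcomm Φ).toBCF x ∂μ) * σ (algPart hcomm Φ)) ∈
      bedFunctions (GroupL1 A μ) := by
  obtain ⟨⟨hcont, -, β, hβ, hBSE⟩, hBED⟩ := hσ
  set L := setIntegralCLM μ hμs with hL
  have hbse : ∀ (Λ : (G →ᵇ ℂ) →L[ℂ] ℂ) (n : ℕ) (c : Fin n → ℂ)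
      (Φ : Fin n → characterSpace ℂ (GroupL1 A μ)),
      ‖∑ i, c i * (Λ (groupPart hcomm (Φ i)).toBCF * σ (algPart hcomm (Φ i)))‖ ≤
        ‖Λ‖ * β * ‖∑ i, c i • CharacterSpace.toCLM (Φ i)‖ := by
    intro Λ n c Φ
    have h := norm_sum_functional_mul_le (μ := μ) Λ hβ hBSE c (fun i => groupPart hcomm (Φ i))
      (fun i => algPart hcomm (Φ i))
    simpa only [prodChar_parts] using h
  refine ⟨⟨(continuous_setIntegral_groupPart hcomm hs hμs).mul
    (hcont.comp (continuous_algPart hcomm)), ⟨‖L‖ * β, fun Φ => ?_⟩, (‖L‖ + 1) * β,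
    by positivity, fun n c Φ => ?_⟩, fun ε hε => ?_⟩
  -- Boundedness is the BSE inequality for a single character.
  · have h := hbse L 1 (fun _ => 1) (fun _ => Φ)
    simp only [Finset.univ_unique, Finset.sum_const, Finset.card_singleton, one_smul,
      one_mul] at h
    exact h.trans (mul_le_of_le_one_right (by positivity) (CharacterSpace.norm_toCLM_le_one Φ))
  · refine (hbse L n c Φ).trans ?_
    gcongr
    linarith
  · obtain ⟨φ₀⟩ := hne
    obtain ⟨b, hb⟩ := CharacterSpace.exists_apply_ne_zero φ₀
    set a₀ := (φ₀ b)⁻¹ • b with ha₀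
    have hφa₀ : φ₀ a₀ = 1 := by rw [ha₀, map_smul, smul_eq_mul, inv_mul_cancel₀ hb]
    -- With ε₁ and ε₂ so chosen, ε₁ β = ε₂ (‖L‖ + ε₁) = ε/2, one half for each term of the
    -- splitting.
    set ε₁ := ε / (2 * β) with hε₁
    have hε₁0 : 0 < ε₁ := by positivity
    set ε₂ := ε / (2 * (‖L‖ + ε₁)) with hε₂
    have hε₂0 : 0 < ε₂ := by positivity
    obtain ⟨K₁, hK₁, hK₁ε⟩ := (hsub ⟨ind hs hμs a₀, rfl⟩).2 ε₁ hε₁0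
    obtain ⟨K₂, hK₂, hK₂ε⟩ := hBED ε₂ hε₂0
    let S : Set (G →ᵇ ℂ) := {h | ∃ γ : BddChar G, prodChar μ γ φ₀ ∉ K₁ ∧ γ.toBCF = h}
    -- At (γ, φ₀) the transform of 1ₛ·a₀ is ∫ₛ γ because φ₀(a₀) = 1, and ‖∑ cᵢ (γᵢ, φ₀)‖ is at most
    -- the sup norm of ∑ cᵢ γᵢ.
    have hLS : ∀ h ∈ Submodule.span ℂ S, ‖L h‖ ≤ ε₁ * ‖h‖ := by
      intro h hh
      obtain ⟨n, c, g, rfl⟩ := Submodule.mem_span_set'.1 hh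
      choose γ hγ hγg using fun i => (g i).2
      simp only [← hγg]
      have h1 := hK₁ε n c (fun i => prodChar μ (γ i) φ₀) hγ
      simp only [prodChar_ind, hφa₀, one_mul, toCLM_prodChar, ← pairing_sum] at h1
      have h2 : L (∑ i, c i • (γ i).toBCF) = ∑ i, c i * ∫ x in s, (γ i).toBCF x ∂μ := by
        rw [map_sum]
        simp [hL, setIntegralCLM_apply]
      rw [h2]
      refine h1.trans (mul_le_mul_of_nonneg_left ((norm_pairing_le _ _).trans ?_) hε₁0.le)
      exact mul_le_of_le_one_left (norm_nonneg _) (CharacterSpace.norm_toCLM_le_one φ₀)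
    obtain ⟨Λ, hΛL, hΛ⟩ := exists_extension_norm_eq (Submodule.span ℂ S)
      (L.comp (Submodule.span ℂ S).subtypeL)
    have hΛε : ‖Λ‖ ≤ ε₁ := by
      rw [hΛ]
      exact ContinuousLinearMap.opNorm_le_bound _ hε₁0.le fun h => hLS h h.2
    have hzero : ∀ γ : BddChar G, prodChar μ γ φ₀ ∉ K₁ → (L - Λ) γ.toBCF = 0 := by
      intro γ hγ
      have h1 := hΛL ⟨γ.toBCF, Submodule.subset_span ⟨γ, hγ, rfl⟩⟩
      rw [sub_apply, h1]
      exact sub_self _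
    refine ⟨_, (hK₁.prod hK₂).image (continuous_prodChar_groupPart hcomm), fun n c Φ hΦ => ?_⟩
    -- Outside the compact set, φᵢ ∈ K₂ forces (γᵢ, φ₀) ∉ K₁, where L - Λ vanishes. Hence σ's
    -- estimate outside K₂ applies to these coefficients.
    have hcoeff : ∀ i, algPart hcomm (Φ i) ∈ K₂ →
        c i * (L - Λ) (groupPart hcomm (Φ i)).toBCF = 0 := by
      intro i hi
      rw [hzero _ fun h1 => hΦ i ⟨(prodChar μ (groupPart hcomm (Φ i)) φ₀, algPart hcomm (Φ i)),
        ⟨h1, hi⟩, ?_⟩, mul_zero]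
      simp only [groupPart_prodChar, prodChar_parts]
    set N := ‖∑ i, c i • CharacterSpace.toCLM (Φ i)‖ with hN
    have e1 := hbse Λ n c Φ
    have e2 := norm_sum_le_of_coeff_eq_zero hK₂ε _ _ hcoeff
    have e3 := norm_sum_smul_functional_le (μ := μ) (L - Λ) c (fun i => groupPart hcomm (Φ i))
      (fun i => algPart hcomm (Φ i))
    simp only [prodChar_parts] at e3
    have e4 : ‖L - Λ‖ ≤ ‖L‖ + ε₁ := (norm_sub_le _ _).trans (by linarith)
    have hsplit : ∑ i, c i * ((∫ x in s, (groupPart hcomm (Φ i)).toBCF x ∂μ) *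
          σ (algPart hcomm (Φ i))) =
        ∑ i, c i * (Λ (groupPart hcomm (Φ i)).toBCF * σ (algPart hcomm (Φ i))) +
        ∑ i, c i * (L - Λ) (groupPart hcomm (Φ i)).toBCF * σ (algPart hcomm (Φ i)) := by
      rw [← Finset.sum_add_distrib]
      refine Finset.sum_congr rfl fun i _ => ?_
      rw [← setIntegralCLM_apply μ hμs, ← hL, sub_apply]
      ring
    rw [hsplit]
    calc _ ≤ ‖Λ‖ * β * N + ε₂ * (‖L - Λ‖ * N) :=
          (norm_add_le _ _).trans (add_le_add e1 (e2.trans (by gcongr)))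
      _ ≤ ε₁ * β * N + ε₂ * ((‖L‖ + ε₁) * N) := by gcongr
      _ = ε * N := by
        have h1 : ε₁ * β = ε / 2 := by rw [hε₁]; field_simp
        have h2 : ε₂ * (‖L‖ + ε₁) = ε / 2 := by
          have : ‖L‖ + ε₁ ≠ 0 := by positivity
          rw [hε₂]; field_simp
        rw [← mul_assoc, h1, h2]
        ring

/-! ### Descent to `A` along the trivial character. -/

variable (G) in
/-- The trivial character of `G`. -/
noncomputable def BddChar.trivial : BddChar G where
  toBCF := BoundedContinuousFunction.const G 1
  map_one := rfl
  map_mul := fun _ _ => (one_mul 1).symm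

theorem prodChar_trivial_apply (φ : characterSpace ℂ A) (f : GroupL1 A μ) :
    prodChar μ (BddChar.trivial G) φ f = φ (∫ x, f x ∂μ) := by
  rw [prodChar_apply, ← CharacterSpace.coe_toCLM φ,
    ← (CharacterSpace.toCLM φ).integral_comp_comm f.integrable_coe]
  simp [BddChar.trivial]

/-- On the characters (1, φ) the transform of 1ₛ·a is μ(s) φ(a), so the BED estimate upstairs with
tolerance μ(s) ε descends; the compact set is projected by `algPart`. -/
theorem gelfandImage_subset_bedFunctions
    (hcomm : ∀ f g : GroupL1 A μ, f * g = g * f)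
    (hsub : gelfandImage (GroupL1 A μ) ⊆ bedFunctions (GroupL1 A μ)) :
    gelfandImage A ⊆ bedFunctions A := by
  rintro _ ⟨a, rfl⟩
  refine ⟨gelfandImage_subset_bseFunctions A ⟨a, rfl⟩, fun ε hε => ?_⟩
  -- Only a set of positive finite measure is wanted; the function 0 and the tolerance 1 are
  -- dummies.
  obtain ⟨s, hs, hμs, hpos, -⟩ := exists_setIntegral_close μ (0 : G →ᵇ ℂ) 1 one_pos
  set m := μ.real s with hm
  obtain ⟨K, hK, hKε⟩ := (hsub ⟨ind hs hμs a, rfl⟩).2 (m * ε) (by positivity)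
  refine ⟨_, hK.image (continuous_algPart hcomm), fun n c φ hφ => ?_⟩
  have h1 := hKε n c (fun i => prodChar μ (BddChar.trivial G) (φ i))
    fun i hi => hφ i ⟨_, hi, algPart_prodChar hcomm _ _⟩
  have h2 : ∀ i, prodChar μ (BddChar.trivial G) (φ i) (ind hs hμs a) = m * φ i a := fun i => by
    rw [prodChar_ind, mul_comm]
    simp [BddChar.trivial, hm]
  have h3 : ∑ i, c i * (m * φ i a) = m * ∑ i, c i * φ i a := by
    rw [Finset.mul_sum]
    exact Finset.sum_congr rfl fun i _ => mul_left_comm _ _ _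
  simp only [h2, h3] at h1
  rw [norm_mul, Complex.norm_real, Real.norm_of_nonneg hpos.le, mul_assoc] at h1
  refine (le_of_mul_le_mul_left h1 hpos).trans (mul_le_mul_of_nonneg_left ?_ hε.le)
  -- The combination of the (1, φᵢ) factors through the contraction f ↦ ∫ f, so its norm is at most
  -- that of ∑ cᵢ φᵢ.
  refine ContinuousLinearMap.opNorm_le_bound _ (norm_nonneg _) fun f => ?_
  have h4 : (∑ i, c i • CharacterSpace.toCLM (prodChar μ (BddChar.trivial G) (φ i))) f =
      (∑ i, c i • CharacterSpace.toCLM (φ i)) (∫ x, f x ∂μ) := by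
    simp [prodChar_trivial_apply]
  rw [h4, norm_eq_integral]
  exact ContinuousLinearMap.le_opNorm_of_le _ (norm_integral_le_integral_norm _)

end BED

end GroupL1

open GroupL1 in
theorem mainTheorem8 {A : Type*} [NonUnitalNormedCommRing A] [NormedSpace ℂ A]
    [IsScalarTower ℂ A A] [SMulCommClass ℂ A A] [CompleteSpace A]
    (hA : IsGelfandSemisimple A)
    {G : Type*} [Group G] [TopologicalSpace G] [IsTopologicalGroup G] [T2Space G]
    [LocallyCompactSpace G] [MeasurableSpace G] [BorelSpace G]
    (μ : Measure G) [μ.IsHaarMeasure] [μ.Regular]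
    (h : IsBED (GroupL1 A μ)) :
    IsBED A := by
  obtain ⟨hcomm, ⟨Φ₀⟩, heq⟩ := h
  have hne : Nonempty (characterSpace ℂ A) := ⟨algPart hcomm Φ₀⟩
  refine ⟨mul_comm, hne, Set.Subset.antisymm (fun σ hσ => ?_)
    (gelfandImage_subset_bedFunctions hcomm heq.ge)⟩
  obtain ⟨s, hs, hμs, hpos, -⟩ := exists_setIntegral_close μ (0 : BoundedContinuousFunction G ℂ)
    1 one_pos
  obtain ⟨F, hF⟩ :=
    heq.le (setIntegral_mul_mem_bedFunctions hcomm heq.ge hne hσ hs hμs)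
  -- At (1, φ) the transform of F is φ(∫ F), while the product function is μ(s) σ(φ).
  refine ⟨((μ.real s : ℂ))⁻¹ • ∫ x, F x ∂μ, funext fun φ => ?_⟩
  have h1 := congrFun hF (prodChar μ (BddChar.trivial G) φ)
  simp only [prodChar_trivial_apply, groupPart_prodChar, algPart_prodChar] at h1
  have h2 : ∫ x in s, (BddChar.trivial G).toBCF x ∂μ = μ.real s := by simp [BddChar.trivial]
  have h3 : (μ.real s : ℂ) ≠ 0 := Complex.ofReal_ne_zero.2 hpos.ne'
  change φ _ = σ φ
  rw [map_smul, h1, h2, smul_eq_mul, inv_mul_cancel_left₀ h3]
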